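/- For a finite group $G$ let $L(G)$ be the set of all subgroups of $G$, let $C(G)$ be the set of all cyclic subgroups of $G$, and let $\operatorname{cdeg}(G)=|C(G)|/|L(G)|$ be the cyclicity degree of $G$. Let $m,n\ge 1$ and $r$ be integers with $\gcd(m,n)=\gcd(m,r-1)=1$ and $r^n\equiv 1\pmod m$, and let $$\mathrm{ZM}(m,n,r)=\langle a,b \mid a^m=b^n=1,\ b^{-1}ab=a^r\rangle .$$ For a divisor $n_1\ge 1$ of $n$ write $\frac{r^n-1}{r^{n_1}-1}$ for the integer $\sum_{i=0}^{n/n_1-1} r^{i n_1}$ (this is the usual quotient if $r^{n_1}\neq 1$, and it is $n/n_1$ if $r^{n_1}=1$). Let $L$ be the set of all triples $(m_1,n_1,s)$ of integers with $m_1,n_1\ge 1$, $m_1\mid m$, $n_1\mid n$, $0\le s\le m_1-1$ and $m_1\mid s\,\frac{r^n-1}{r^{n_1}-1}$, and let $L'$ be the set of those $(m_1,n_1,s)\in L$ for which $\frac{m}{m_1}\mid r^{n_1}-1$. Then $$\operatorname{cdeg}(\mathrm{ZM}(m,n,r))=\frac{|L'|}{|L|},$$ where $$|L(\mathrm{ZM}(m,n,r))|=|L|=\sum_{m_1\mid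 m}\ \sum_{n_1\mid n}\gcd\Big(m_1,\frac{r^n-1}{r^{n_1}-1}\Big)$$ and $$|C(\mathrm{ZM}(m,n,r))|=|L'|=\sum_{m_1\mid m}\ \sum_{\substack{n_1\mid n\\ m/m_1\,\mid\, r^{n_1}-1}}\gcd\Big(m_1,\frac{r^n-1}{r^{n_1}-1}\Big).$$ -/

import Mathlib

/-- The cyclicity degree `cdeg(G) = |C(G)| / |L(G)|` of a finite group `G`, where `C(G)` is the
set of cyclic subgroups of `G` and `L(G)` is the set of all subgroups of `G`. -/
noncomputable def cdeg (G : Type*) [Group G] : ℚ :=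
  (Nat.card {H : Subgroup G // IsCyclic H} : ℚ) / (Nat.card (Subgroup G) : ℚ)

/-- The relators of `⟨a, b ∣ a ^ m = b ^ n = 1, b⁻¹ a b = a ^ r⟩`, with `a` the generator of
index `0` and `b` the generator of index `1`. -/
def zmRels (m n : ℕ) (r : ℤ) : Set (FreeGroup (Fin 2)) :=
  {FreeGroup.of 0 ^ m, FreeGroup.of 1 ^ n,
    (FreeGroup.of 1)⁻¹ * FreeGroup.of 0 * FreeGroup.of 1 * (FreeGroup.of 0 ^ r)⁻¹}

/-- The group `ZM(m, n, r) = ⟨a, b ∣ a ^ m = b ^ n = 1, b⁻¹ a b = a ^ r⟩`. -/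
abbrev ZM (m n : ℕ) (r : ℤ) : Type := PresentedGroup (zmRels m n r)

/-- The integer `(r ^ n - 1) / (r ^ n₁ - 1)`, for a divisor `n₁` of `n`. In the degenerate case
`r ^ n₁ = 1`, where this reads `0 / 0`, it is `n / n₁`, the value at `x = r` of the polynomial
`(x ^ n - 1) / (x ^ n₁ - 1) = 1 + x ^ n₁ + x ^ (2 n₁) + ⋯ + x ^ (n - n₁)`
(see `zmQuot_eq_sum`). -/
def zmQuot (r : ℤ) (n n₁ : ℕ) : ℤ :=
  if r ^ n₁ = 1 then ((n / n₁ : ℕ) : ℤ) else (r ^ n - 1) / (r ^ n₁ - 1)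

theorem zmQuot_eq_sum (r : ℤ) {n n₁ : ℕ} (h : n₁ ∣ n) :
    zmQuot r n n₁ = ∑ i ∈ Finset.range (n / n₁), (r ^ n₁) ^ i := by
  unfold zmQuot
  split_ifs with h1
  · simp [h1]
  · have h2 : r ^ n₁ - 1 ≠ 0 := sub_ne_zero.mpr h1
    have h3 := geom_sum_mul (r ^ n₁) (n / n₁)
    rw [← pow_mul, Nat.mul_div_cancel' h] at h3
    rw [← h3, Int.mul_ediv_cancel _ h2]

/-- The set `L` of triples `(m₁, n₁, s)` with `m₁ ∣ m`, `n₁ ∣ n`, `0 ≤ s ≤ m₁ - 1` and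
`m₁ ∣ s (r ^ n - 1) / (r ^ n₁ - 1)`. -/
def zmL (m n : ℕ) (r : ℤ) : Set (ℕ × ℕ × ℕ) :=
  {t | 0 < t.1 ∧ 0 < t.2.1 ∧ t.1 ∣ m ∧ t.2.1 ∣ n ∧ t.2.2 < t.1 ∧
    (t.1 : ℤ) ∣ (t.2.2 : ℤ) * zmQuot r n t.2.1}

/-- The set `L'` of triples `(m₁, n₁, s)` in `L` with `m / m₁ ∣ r ^ n₁ - 1`. -/
def zmL' (m n : ℕ) (r : ℤ) : Set (ℕ × ℕ × ℕ) :=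
  {t | t ∈ zmL m n r ∧ ((m / t.1 : ℕ) : ℤ) ∣ r ^ t.2.1 - 1}

/-! A subgroup `H` is recovered from three data: `m₁`, where `H ∩ ⟨a⟩ = ⟨a ^ m₁⟩`; `n₁`, where `b ^
n₁` generates the image of `H` modulo `⟨a⟩`; and the residue `s` modulo `m₁` with `b ^ n₁ * a ^ s ∈
H`. The `n / n₁`-th power of that element is `a ^ (s * zmQuot r n n₁)`, so the divisibility in `zmL`
is necessary; it is also what keeps the subgroup of a triple from meeting `⟨a⟩` in more than `⟨a ^
m₁⟩`. Hence `tripleSubgroup` is a bijection from `zmL` to subgroups (`injOn_tripleSubgroup`,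
`exists_tripleSubgroup_eq`).

The two generators commute exactly when `m / m₁ ∣ r ^ n₁ - 1`, and coprimality of `m` and `n` then
merges them into one (`isCyclic_tripleSubgroup_iff`). `ZM.isMetacyclicPair` shows that the
presentation does not collapse. For fixed `m₁`, `n₁`, the admissible `s` are counted by a gcd
(`card_filter_dvd_mul`). -/

/-- The elements `a` and `b` generate `G`, satisfy the relations of `ZM(m, n, r)`, and `a` has order
exactly `m` while `b` has order `n` modulo `⟨a⟩`. -/
structure IsMetacyclicPair {G : Type*} [Group G] (m n : ℕ) (r : ℤ) (a b : G) : Prop where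
  orderOf_left : orderOf a = m
  pow_right : b ^ n = 1
  mul_left_right : a * b = b * a ^ r
  closure_eq_top : Subgroup.closure {a, b} = ⊤
  exists_hom : ∃ φ : G →* Multiplicative (ZMod n), φ a = 1 ∧ φ b = Multiplicative.ofAdd 1

/-- The subgroup `⟨a ^ m₁, b ^ n₁ a ^ s⟩` attached to the triple `(m₁, n₁, s)`. -/
def tripleSubgroup {G : Type*} [Group G] (a b : G) (t : ℕ × ℕ × ℕ) : Subgroup G :=
  Subgroup.zpowers (b ^ t.2.1 * a ^ t.2.2) ⊔ Subgroup.zpowers (a ^ t.1)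

/-- Subgroups of `ℤ` are principal; this is what extracts `m₁` and `n₁` from a subgroup. -/
theorem exists_int_dvd_iff (P : ℤ → Prop) (h0 : P 0) (hsub : ∀ i j, P i → P j → P (i - j)) :
    ∃ x : ℤ, ∀ j, P j ↔ x ∣ j := by
  obtain ⟨x, hx⟩ := Int.subgroup_cyclic (AddSubgroup.ofSub {j | P j} ⟨0, h0⟩ fun i hi j hj => by
    simpa [sub_eq_add_neg] using hsub i j hi hj)
  refine ⟨x, fun j => ?_⟩
  rw [← Int.mem_zmultiples_iff, AddSubgroup.zmultiples_eq_closure, ← hx]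
  rfl

namespace IsMetacyclicPair

variable {G : Type*} [Group G] {m n : ℕ} {r : ℤ} {a b : G}

/-! ### Commutation rules and normal form -/

theorem zpow_eq_zpow (h : IsMetacyclicPair m n r a b) {i j : ℤ} (hij : a ^ i = a ^ j) :
    (m : ℤ) ∣ i - j := by
  rw [← h.orderOf_left, orderOf_dvd_iff_zpow_eq_one, zpow_sub, hij, mul_inv_cancel]

theorem zpow_mul_right (h : IsMetacyclicPair m n r a b) (j : ℤ) :
    a ^ j * b = b * a ^ (j * r) := by
  have h1 : SemiconjBy b (a ^ r) a := h.mul_left_right.symm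
  have h2 := h1.zpow_right j
  rw [← zpow_mul, mul_comm r j] at h2
  exact h2.symm

theorem zpow_mul_pow (h : IsMetacyclicPair m n r a b) (j : ℤ) (i : ℕ) :
    a ^ j * b ^ i = b ^ i * a ^ (j * r ^ i) := by
  induction i with
  | zero => simp
  | succ i ih => rw [pow_succ, ← mul_assoc, ih, mul_assoc, h.zpow_mul_right, ← mul_assoc,
      mul_assoc j, ← pow_succ, ← pow_succ]

theorem mul_pow_eq (h : IsMetacyclicPair m n r a b) (n₁ s k : ℕ) :
    (b ^ n₁ * a ^ s) ^ k =
      b ^ (n₁ * k) * a ^ ((s : ℤ) * ∑ i ∈ Finset.range k, (r ^ n₁) ^ i) := by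
  induction k with
  | zero => simp
  | succ k ih =>
    rw [pow_succ, ih, mul_assoc, ← mul_assoc (a ^ _), h.zpow_mul_pow, geom_sum_succ, mul_add,
      mul_one, mul_add, mul_one, zpow_add, zpow_natCast, pow_add, mul_comm (r ^ n₁),
      ← mul_assoc (s : ℤ)]
    simp only [mul_assoc]

theorem exists_zpow_mul (h : IsMetacyclicPair m n r a b) (hn : 0 < n) (g : G) :
    ∃ e : ℤ, ∀ j : ℤ, a ^ j * g = g * a ^ (j * e) := by
  have hg : g ∈ Subgroup.closure {a, b} := h.closure_eq_top ▸ Subgroup.mem_top g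
  -- Writing `b⁻¹` as a positive power avoids inverting `r` modulo `m`.
  have hb : b⁻¹ = b ^ (n - 1) := by
    rw [inv_eq_iff_mul_eq_one, ← pow_succ', Nat.sub_add_cancel hn, h.pow_right]
  induction hg using Subgroup.closure_induction'' with
  | one => exact ⟨1, by simp⟩
  | mem x hx =>
    rcases hx with rfl | rfl
    · exact ⟨1, fun j => by rw [mul_one, ← zpow_add_one, ← zpow_one_add, add_comm]⟩
    · exact ⟨r, h.zpow_mul_right⟩
  | inv_mem x hx =>
    rcases hx with rfl | rfl
    · exact ⟨1, fun j => by rw [mul_one]; exact (Commute.zpow_self x j).inv_right.eq⟩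
    · exact ⟨r ^ (n - 1), fun j => by rw [hb, h.zpow_mul_pow]⟩
  | mul x y _ _ hx hy =>
    obtain ⟨e, he⟩ := hx
    obtain ⟨f, hf⟩ := hy
    exact ⟨e * f, fun j => by rw [← mul_assoc, he, mul_assoc, hf, mul_assoc, mul_assoc]⟩

theorem normal_zpowers (h : IsMetacyclicPair m n r a b) (hn : 0 < n) (k : ℕ) :
    (Subgroup.zpowers (a ^ k)).Normal := by
  refine ⟨fun x hx g => ?_⟩
  obtain ⟨l, rfl⟩ := hx
  obtain ⟨e, he⟩ := h.exists_zpow_mul hn g⁻¹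
  refine ⟨l * e, ?_⟩
  simp only [← zpow_natCast, ← zpow_mul]
  rw [mul_assoc, he, mul_inv_cancel_left, mul_assoc]

theorem exists_eq_mul (h : IsMetacyclicPair m n r a b) (hn : 0 < n) (g : G) :
    ∃ i j : ℤ, g = b ^ i * a ^ j := by
  have hN : (Subgroup.zpowers a).Normal := by simpa using h.normal_zpowers hn 1
  have hg : g ∈ Subgroup.zpowers b ⊔ Subgroup.zpowers a := by
    have hle : Subgroup.closure {a, b} ≤ Subgroup.zpowers b ⊔ Subgroup.zpowers a := by
      rw [Subgroup.closure_le]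
      rintro x (rfl | rfl)
      · exact Subgroup.mem_sup_right (Subgroup.mem_zpowers x)
      · exact Subgroup.mem_sup_left (Subgroup.mem_zpowers x)
    exact hle (h.closure_eq_top ▸ Subgroup.mem_top g)
  obtain ⟨y, ⟨i, rfl⟩, z, ⟨j, rfl⟩, rfl⟩ := Subgroup.mem_sup_of_normal_right.mp hg
  exact ⟨i, j, rfl⟩

/-! ### Subgroups attached to triples -/

theorem mem_tripleSubgroup_iff (h : IsMetacyclicPair m n r a b) (hn : 0 < n) {t : ℕ × ℕ × ℕ}
    {g : G} : g ∈ tripleSubgroup a b t ↔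
      ∃ k l : ℤ, g = (b ^ t.2.1 * a ^ t.2.2) ^ k * (a ^ t.1) ^ l := by
  have hN := h.normal_zpowers hn t.1
  rw [tripleSubgroup, Subgroup.mem_sup_of_normal_right]
  constructor
  · rintro ⟨y, ⟨i, rfl⟩, z, ⟨j, rfl⟩, rfl⟩
    exact ⟨i, j, rfl⟩
  · rintro ⟨i, j, rfl⟩
    exact ⟨_, ⟨i, rfl⟩, _, ⟨j, rfl⟩, rfl⟩

theorem dvd_of_zpow_mem_zpowers (h : IsMetacyclicPair m n r a b) {m₁ : ℕ} (hm₁ : m₁ ∣ m) {j : ℤ}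
    (hj : a ^ j ∈ Subgroup.zpowers (a ^ m₁)) : (m₁ : ℤ) ∣ j := by
  obtain ⟨l, hl⟩ := hj
  simp only [← zpow_natCast, ← zpow_mul] at hl
  have h1 := (Int.natCast_dvd_natCast.mpr hm₁).trans (h.zpow_eq_zpow hl)
  exact (dvd_sub_right (dvd_mul_right _ _)).mp h1

theorem zpow_mem_zpowers {m₁ : ℕ} {j : ℤ} (hj : (m₁ : ℤ) ∣ j) :
    a ^ j ∈ Subgroup.zpowers (a ^ m₁) := by
  obtain ⟨l, rfl⟩ := hj
  exact ⟨l, by simp only [← zpow_natCast, ← zpow_mul]⟩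

theorem mul_pow_div (h : IsMetacyclicPair m n r a b) {n₁ : ℕ} (hn₁ : n₁ ∣ n) (s : ℕ) :
    (b ^ n₁ * a ^ s) ^ (n / n₁) = a ^ ((s : ℤ) * zmQuot r n n₁) := by
  rw [h.mul_pow_eq, Nat.mul_div_cancel' hn₁, h.pow_right, one_mul, zmQuot_eq_sum r hn₁]

/-- Modulo `⟨a⟩`, the exponent of `b ^ n₁ * a ^ s` must be a multiple of `n / n₁`, and such powers
already lie in `⟨a ^ m₁⟩`. -/
theorem zpow_mem_tripleSubgroup_iff (h : IsMetacyclicPair m n r a b) (hn : 0 < n)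
    {t : ℕ × ℕ × ℕ} (ht : t ∈ zmL m n r) (j : ℤ) :
    a ^ j ∈ tripleSubgroup a b t ↔ (t.1 : ℤ) ∣ j := by
  obtain ⟨h1, h2, h3, h4, h5, h6⟩ := ht
  constructor
  · intro hj
    obtain ⟨k, l, hkl⟩ := (h.mem_tripleSubgroup_iff hn).mp hj
    obtain ⟨φ, hφa, hφb⟩ := h.exists_hom
    have hφ := congrArg (fun x => Multiplicative.toAdd (φ x)) hkl
    simp only [map_mul, map_zpow, map_pow, hφa, hφb, one_zpow, one_pow, mul_one, toAdd_one,
      toAdd_zpow, toAdd_pow, toAdd_ofAdd] at hφ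
    have hd : (n : ℤ) ∣ k * t.2.1 := by
      rw [← ZMod.intCast_zmod_eq_zero_iff_dvd]
      simpa using hφ.symm
    have hk : ((n / t.2.1 : ℕ) : ℤ) ∣ k := by
      have h7 : (n : ℤ) = ((n / t.2.1 : ℕ) : ℤ) * t.2.1 := by
        exact_mod_cast (Nat.div_mul_cancel h4).symm
      rw [h7] at hd
      exact Int.dvd_of_mul_dvd_mul_right (by exact_mod_cast h2.ne') hd
    obtain ⟨d, rfl⟩ := hk
    refine h.dvd_of_zpow_mem_zpowers h3 ?_
    rw [hkl, zpow_mul, zpow_natCast, h.mul_pow_div h4]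
    exact mul_mem (zpow_mem (zpow_mem_zpowers h6) _) (zpow_mem (Subgroup.mem_zpowers _) _)
  · exact fun hj => Subgroup.mem_sup_right (zpow_mem_zpowers hj)

theorem dvd_of_mul_mem_tripleSubgroup (h : IsMetacyclicPair m n r a b) (hn : 0 < n)
    {t : ℕ × ℕ × ℕ} (ht : t ∈ zmL m n r) {i j : ℤ} (hij : b ^ i * a ^ j ∈ tripleSubgroup a b t) :
    (t.2.1 : ℤ) ∣ i := by
  obtain ⟨k, l, hkl⟩ := (h.mem_tripleSubgroup_iff hn).mp hij
  obtain ⟨φ, hφa, hφb⟩ := h.exists_hom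
  have hφ := congrArg (fun x => Multiplicative.toAdd (φ x)) hkl
  simp only [map_mul, map_zpow, map_pow, hφa, hφb, one_zpow, one_pow, mul_one,
    toAdd_zpow, toAdd_pow, toAdd_ofAdd] at hφ
  have hd : (n : ℤ) ∣ k * t.2.1 - i := by
    rw [← ZMod.intCast_eq_intCast_iff_dvd_sub]
    simpa using hφ
  have h1 := (Int.natCast_dvd_natCast.mpr ht.2.2.2.1).trans hd
  exact (dvd_sub_right (dvd_mul_left _ _)).mp h1

theorem mul_mem_tripleSubgroup (t : ℕ × ℕ × ℕ) :
    b ^ t.2.1 * a ^ t.2.2 ∈ tripleSubgroup a b t :=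
  Subgroup.mem_sup_left (Subgroup.mem_zpowers _)

theorem injOn_tripleSubgroup (h : IsMetacyclicPair m n r a b) (hn : 0 < n) :
    Set.InjOn (tripleSubgroup a b) (zmL m n r) := by
  have hfst : ∀ t ∈ zmL m n r, ∀ u ∈ zmL m n r, tripleSubgroup a b t = tripleSubgroup a b u →
      t.1 ∣ u.1 := fun t ht u hu htu => by
    rw [← Int.natCast_dvd_natCast, ← h.zpow_mem_tripleSubgroup_iff hn ht, htu,
      h.zpow_mem_tripleSubgroup_iff hn hu]
  have hsnd : ∀ t ∈ zmL m n r, ∀ u ∈ zmL m n r, tripleSubgroup a b t = tripleSubgroup a b u →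
      t.2.1 ∣ u.2.1 := fun t ht u hu htu => by
    have h1 := mul_mem_tripleSubgroup (a := a) (b := b) u
    rw [← htu, ← zpow_natCast, ← zpow_natCast] at h1
    exact_mod_cast h.dvd_of_mul_mem_tripleSubgroup hn ht h1
  rintro ⟨m₁, n₁, s⟩ ht ⟨m₂, n₂, u⟩ hu htu
  obtain rfl : m₁ = m₂ := Nat.dvd_antisymm (hfst _ ht _ hu htu) (hfst _ hu _ ht htu.symm)
  obtain rfl : n₁ = n₂ := Nat.dvd_antisymm (hsnd _ ht _ hu htu) (hsnd _ hu _ ht htu.symm)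
  have h1 := mul_mem_tripleSubgroup (a := a) (b := b) (m₁, n₁, s)
  have h2 := mul_mem_tripleSubgroup (a := a) (b := b) (m₁, n₁, u)
  rw [← htu] at h2
  have h3 := mul_mem (inv_mem h1) h2
  have h4 : (b ^ n₁ * a ^ s)⁻¹ * (b ^ n₁ * a ^ u) = a ^ ((u : ℤ) - s) := by
    rw [zpow_sub, zpow_natCast, zpow_natCast, mul_inv_rev, mul_assoc, inv_mul_cancel_left]
    exact ((Commute.pow_pow_self a s u).inv_left).eq
  rw [h4, h.zpow_mem_tripleSubgroup_iff hn ht] at h3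
  have h5 : s = u := by
    have := (Nat.modEq_iff_dvd (n := m₁) (a := s) (b := u)).mpr h3
    rwa [Nat.ModEq, Nat.mod_eq_of_lt ht.2.2.2.2.1, Nat.mod_eq_of_lt hu.2.2.2.2.1] at this
  rw [h5]

theorem exists_tripleSubgroup_eq (h : IsMetacyclicPair m n r a b) (hm : 0 < m) (hn : 0 < n)
    (H : Subgroup G) : ∃ t ∈ zmL m n r, tripleSubgroup a b t = H := by
  have hN : (Subgroup.zpowers a).Normal := by simpa using h.normal_zpowers hn 1
  obtain ⟨x, hx⟩ : ∃ x : ℤ, ∀ j : ℤ, a ^ j ∈ H ↔ x ∣ j := by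
    exact exists_int_dvd_iff _ (by simp) (fun i j hi hj => by
      rw [zpow_sub]; exact mul_mem hi (inv_mem hj))
  -- The exponents of `b` occurring in `H` form a subgroup of `ℤ`, since `⟨a⟩` is normalized by `b`.
  obtain ⟨y, hy⟩ : ∃ y : ℤ, ∀ i : ℤ, (∃ j : ℤ, b ^ i * a ^ j ∈ H) ↔ y ∣ i := by
    refine exists_int_dvd_iff _ ⟨0, by simp⟩ ?_
    rintro i i' ⟨j, hj⟩ ⟨j', hj'⟩
    obtain ⟨e, he⟩ := h.exists_zpow_mul hn (b ^ (-i'))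
    have h1 := mul_mem hj (inv_mem hj')
    rw [mul_inv_rev, mul_assoc, ← mul_assoc (a ^ j), ← zpow_neg, ← zpow_neg, ← zpow_add, he,
      ← mul_assoc, ← zpow_add, ← sub_eq_add_neg] at h1
    exact ⟨_, h1⟩
  have hxm : x.natAbs ∣ m := by
    rw [← Int.natCast_dvd_natCast, Int.natAbs_dvd, ← hx, ← h.orderOf_left, zpow_natCast,
      pow_orderOf_eq_one]
    exact H.one_mem
  have hyn : y.natAbs ∣ n := by
    rw [← Int.natCast_dvd_natCast, Int.natAbs_dvd, ← hy]
    exact ⟨0, by simp [h.pow_right]⟩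
  have hx0 : 0 < x.natAbs := Nat.pos_of_dvd_of_pos hxm hm
  have hy0 : 0 < y.natAbs := Nat.pos_of_dvd_of_pos hyn hn
  obtain ⟨j, hj⟩ := (hy y.natAbs).mpr (Int.dvd_natAbs.mpr dvd_rfl)
  have hxH : a ^ x.natAbs ∈ H := by
    rw [← zpow_natCast, hx]
    exact Int.dvd_natAbs.mpr dvd_rfl
  obtain ⟨s, hs⟩ : ∃ s : ℕ, (s : ℤ) = j % x.natAbs :=
    ⟨(j % x.natAbs).toNat, Int.toNat_of_nonneg (Int.emod_nonneg _ (by exact_mod_cast hx0.ne'))⟩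
  have hsx : s < x.natAbs := by
    have := Int.emod_lt_of_pos j (b := x.natAbs) (by exact_mod_cast hx0)
    omega
  have hsH : b ^ y.natAbs * a ^ s ∈ H := by
    have h1 : (s : ℤ) = j + x.natAbs * (-(j / x.natAbs)) := by
      rw [hs, Int.emod_def]; ring
    rw [← zpow_natCast, ← zpow_natCast a, h1, zpow_add, ← mul_assoc, zpow_mul, zpow_natCast a]
    exact mul_mem hj (zpow_mem hxH _)
  have hle : tripleSubgroup a b (x.natAbs, y.natAbs, s) ≤ H := by
    rw [tripleSubgroup, sup_le_iff, Subgroup.zpowers_le, Subgroup.zpowers_le]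
    exact ⟨hsH, hxH⟩
  refine ⟨(x.natAbs, y.natAbs, s), ⟨hx0, hy0, hxm, hyn, hsx, ?_⟩, le_antisymm hle ?_⟩
  · rw [Int.natAbs_dvd, ← hx, ← h.mul_pow_div hyn]
    exact pow_mem hsH _
  · intro g hg
    obtain ⟨i, l, rfl⟩ := h.exists_eq_mul hn g
    obtain ⟨k, rfl⟩ := Int.natAbs_dvd.mpr ((hy i).mp ⟨l, hg⟩)
    -- Dividing by the `k`-th power of the first generator leaves an element of `H ∩ ⟨a⟩`.
    have hker : b ^ (y.natAbs * k : ℤ) * a ^ l =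
        (b ^ y.natAbs * a ^ s) ^ k * ((b ^ y.natAbs * a ^ s) ^ (-k) * (b ^ (y.natAbs * k : ℤ) * a ^ l)) := by
      group
    obtain ⟨j', hj'⟩ : (b ^ y.natAbs * a ^ s) ^ (-k) * (b ^ (y.natAbs * k : ℤ) * a ^ l) ∈
        Subgroup.zpowers a := by
      rw [← QuotientGroup.eq_one_iff]
      rw [zpow_mul, zpow_natCast]
      simp
    simp only at hj'
    have hmem := mul_mem (zpow_mem hsH (-k)) hg
    rw [← hj', hx] at hmem
    rw [hker, ← hj']
    exact mul_mem (zpow_mem (mul_mem_tripleSubgroup _) _)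
      (Subgroup.mem_sup_right (zpow_mem_zpowers (Int.natAbs_dvd.mpr hmem)))

/-! ### Cyclic subgroups -/

theorem isCyclic_tripleSubgroup_iff (h : IsMetacyclicPair m n r a b)
    (hmn : Nat.Coprime m n) {t : ℕ × ℕ × ℕ} (ht : t ∈ zmL m n r) :
    IsCyclic (tripleSubgroup a b t) ↔ ((m / t.1 : ℕ) : ℤ) ∣ r ^ t.2.1 - 1 := by
  obtain ⟨m₁, n₁, s⟩ := t
  obtain ⟨h1, h2, h3, h4, h5, h6⟩ := ht
  simp only at h1 h2 h3 h4 h5 h6 ⊢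
  have hcomm : Commute (b ^ n₁ * a ^ s) (a ^ m₁) ↔ ((m / m₁ : ℕ) : ℤ) ∣ r ^ n₁ - 1 := by
    have e1 : Commute (b ^ n₁ * a ^ s) (a ^ m₁) ↔
        a ^ ((m₁ : ℤ) * r ^ n₁) = a ^ (m₁ : ℤ) := by
      have e2 := h.zpow_mul_pow m₁ n₁
      rw [zpow_natCast] at e2
      rw [commute_iff_eq, ← mul_assoc, e2, mul_assoc, mul_assoc, mul_right_inj,
        (Commute.pow_pow_self a s m₁).eq, ← zpow_natCast a s, ← zpow_natCast a m₁, mul_left_inj,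
        eq_comm]
    rw [e1, ← mul_inv_eq_one, ← zpow_neg, ← zpow_add, ← orderOf_dvd_iff_zpow_eq_one,
      h.orderOf_left]
    have e3 : (m : ℤ) = m₁ * ((m / m₁ : ℕ) : ℤ) := by
      exact_mod_cast (Nat.mul_div_cancel' h3).symm
    have e4 : (m₁ : ℤ) * r ^ n₁ + -m₁ = m₁ * (r ^ n₁ - 1) := by ring
    rw [e4]
    conv_lhs => rw [e3]
    exact mul_dvd_mul_iff_left (by exact_mod_cast h1.ne')
  rw [← hcomm]
  set c := b ^ n₁ * a ^ s with hc
  set y := a ^ m₁ with hy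
  have hcK : c ∈ tripleSubgroup a b (m₁, n₁, s) := mul_mem_tripleSubgroup _
  have hyK : y ∈ tripleSubgroup a b (m₁, n₁, s) := Subgroup.mem_sup_right (Subgroup.mem_zpowers _)
  constructor
  · intro hcyc
    have := hcyc.isMulCommutative
    exact congrArg Subtype.val (mul_comm' (⟨c, hcK⟩ : tripleSubgroup a b (m₁, n₁, s)) ⟨y, hyK⟩)
  · intro hcy
    have hym : y ^ m = 1 := by
      rw [hy, ← pow_mul, mul_comm, pow_mul, ← h.orderOf_left, pow_orderOf_eq_one, one_pow]
    obtain ⟨l, hl⟩ : c ^ n ∈ Subgroup.zpowers y := by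
      rw [← Nat.div_mul_cancel h4, pow_mul, h.mul_pow_div h4]
      exact pow_mem (zpow_mem_zpowers h6) _
    simp only at hl
    have hcmn : c ^ (n * m) = 1 := by
      rw [pow_mul, ← hl, ← zpow_natCast, ← zpow_mul, mul_comm, zpow_mul, zpow_natCast, hym,
        one_zpow]
    have hz : ∀ k : ℕ, (c ^ m * y) ^ k = c ^ (m * k) * y ^ k := fun k => by
      rw [(hcy.pow_left m).mul_pow, pow_mul]
    -- The candidate generator is `c ^ m * y`: its `n`-th power is `y ^ n`, and `n` is invertible
    -- modulo `m`.
    have hyz : y ∈ Subgroup.zpowers (c ^ m * y) := by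
      have e := Nat.gcd_eq_gcd_ab m n
      rw [hmn.gcd_eq_one] at e
      have e1 : y = ((c ^ m * y) ^ n) ^ (Nat.gcdB m n) := by
        rw [hz, mul_comm m n, hcmn, one_mul]
        conv_lhs => rw [← zpow_one y, ← Nat.cast_one, e, zpow_add, zpow_mul, zpow_natCast, hym,
          one_zpow, one_mul, zpow_mul, zpow_natCast]
      have e2 := zpow_mem (pow_mem (Subgroup.mem_zpowers (c ^ m * y)) n) (Nat.gcdB m n)
      rwa [← e1] at e2
    -- Its `m`-th power is `c ^ (m * m)`, while `c ^ n` is a power of `y`; Bézout for `m * m` and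
    -- `n` then yields `c`.
    have hcz : c ∈ Subgroup.zpowers (c ^ m * y) := by
      have e := Nat.gcd_eq_gcd_ab (m * m) n
      rw [(Nat.Coprime.mul_left hmn hmn).gcd_eq_one] at e
      have e1 : c = ((c ^ m * y) ^ m) ^ (Nat.gcdA (m * m) n) * (y ^ l) ^ (Nat.gcdB (m * m) n) := by
        rw [hz, hym, mul_one, hl, ← zpow_natCast, ← zpow_natCast, ← zpow_mul, ← zpow_mul,
          ← zpow_add, ← e, Nat.cast_one, zpow_one]
      have e2 := mul_mem
        (zpow_mem (pow_mem (Subgroup.mem_zpowers (c ^ m * y)) m) (Nat.gcdA (m * m) n))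
        (zpow_mem (zpow_mem hyz l) (Nat.gcdB (m * m) n))
      rwa [← e1] at e2
    have hK : tripleSubgroup a b (m₁, n₁, s) = Subgroup.zpowers (c ^ m * y) := by
      apply le_antisymm
      · rw [tripleSubgroup, sup_le_iff, Subgroup.zpowers_le, Subgroup.zpowers_le]
        exact ⟨hcz, hyz⟩
      · rw [Subgroup.zpowers_le]
        exact mul_mem (pow_mem hcK _) hyK
    rw [hK]
    infer_instance

end IsMetacyclicPair

/-! ### The presented group -/

theorem ZM.isMetacyclicPair {m n : ℕ} {r : ℤ} (hn : 0 < n) (hr : r ^ n ≡ 1 [ZMOD (m : ℤ)]) :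
    IsMetacyclicPair m n r (PresentedGroup.of 0 : ZM m n r) (PresentedGroup.of 1) := by
  have hrel : ∀ x ∈ zmRels m n r, (PresentedGroup.mk (zmRels m n r) x) = 1 :=
    fun x hx => PresentedGroup.one_of_mem hx
  have ha : (PresentedGroup.of 0 : ZM m n r) ^ m = 1 := hrel (FreeGroup.of 0 ^ m) (by simp [zmRels])
  have hb : (PresentedGroup.of 1 : ZM m n r) ^ n = 1 := hrel (FreeGroup.of 1 ^ n) (by simp [zmRels])
  have hab : (PresentedGroup.of 1 : ZM m n r)⁻¹ * PresentedGroup.of 0 * PresentedGroup.of 1 *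
      (PresentedGroup.of 0 ^ r)⁻¹ = 1 :=
    hrel ((FreeGroup.of 1)⁻¹ * FreeGroup.of 0 * FreeGroup.of 1 * (FreeGroup.of 0 ^ r)⁻¹)
      (by simp [zmRels])
  refine ⟨?_, hb, ?_, ?_, ?_⟩
  · have hrn : (r : ZMod m) ^ n = 1 := by
      have := (ZMod.intCast_eq_intCast_iff _ _ _).mpr hr
      simpa using this
    obtain ⟨u, hu⟩ : IsUnit (r : ZMod m) := IsUnit.of_pow_eq_one hrn hn.ne'
    have hun : u ^ n = 1 := Units.ext (by simpa [hu] using hrn)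
    -- Affine model on `ZMod m`: translation by `1` has order `m`, and conjugating it by
    -- multiplication by `u⁻¹` as `b⁻¹ * a * b` gives translation by `u = r`.
    let f : Fin 2 → Equiv.Perm (ZMod m) := ![Equiv.addRight 1, MulAction.toPerm u⁻¹]
    have hadd : ∀ k : ℤ, (f 0) ^ k = Equiv.addRight (k : ZMod m) := fun k => by
      have h0 : f 0 = Equiv.addRight (1 : ZMod m) := rfl
      rw [h0]
      induction k with
      | zero => ext; simp
      | succ k ih => rw [zpow_add_one, ih]; ext; simp; ring
      | pred k ih => rw [zpow_sub_one, ih]; ext; simp; ring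
    have hf : ∀ x ∈ zmRels m n r, FreeGroup.lift f x = 1 := by
      rintro x (rfl | rfl | rfl)
      · rw [map_pow, FreeGroup.lift_apply_of, ← zpow_natCast, hadd]
        ext; simp
      · rw [map_pow, FreeGroup.lift_apply_of]
        change (MulAction.toPermHom _ _ u⁻¹) ^ n = 1
        rw [← map_pow, inv_pow, hun, inv_one, map_one]
      · simp only [map_mul, map_inv, map_zpow, FreeGroup.lift_apply_of, hadd]
        rw [mul_inv_eq_one]
        have h0 : f 0 = Equiv.addRight (1 : ZMod m) := rfl
        have h1 : f 1 = MulAction.toPerm u⁻¹ := rfl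
        rw [mul_assoc, inv_mul_eq_iff_eq_mul, h0, h1]
        ext x
        simp [Units.smul_def, ← hu]
    refine Nat.dvd_antisymm (orderOf_dvd_of_pow_eq_one ha) ?_
    have h1 := orderOf_map_dvd (PresentedGroup.toGroup hf) (PresentedGroup.of 0)
    rw [PresentedGroup.toGroup.of] at h1
    refine dvd_trans ?_ h1
    have h2 := pow_orderOf_eq_one (f 0)
    rw [← zpow_natCast, hadd] at h2
    have h3 := Equiv.congr_fun h2 0
    simp only [Equiv.coe_addRight, zero_add, Equiv.Perm.coe_one, id_eq, Int.cast_natCast] at h3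
    exact (ZMod.natCast_eq_zero_iff _ _).mp h3
  · rw [mul_inv_eq_one, mul_assoc, inv_mul_eq_iff_eq_mul] at hab
    exact hab
  · rw [← PresentedGroup.closure_range_of]
    congr 1
    ext x
    simp [Fin.exists_fin_two, eq_comm]
  · let f : Fin 2 → Multiplicative (ZMod n) := ![1, Multiplicative.ofAdd 1]
    have hf : ∀ x ∈ zmRels m n r, FreeGroup.lift f x = 1 := by
      rintro x (rfl | rfl | rfl)
      · simp [f]
      · simp [f, ← ofAdd_nsmul]
      · simp [f]
    exact ⟨PresentedGroup.toGroup hf, by simp [f], by simp [f]⟩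

/-! ### Counting triples -/

/-- With `g` the gcd, the condition reduces to `m₁ / g ∣ s`, which has `g` solutions below `m₁`. -/
theorem card_filter_dvd_mul (m₁ : ℕ) (h : 0 < m₁) (q : ℤ) :
    ((Finset.range m₁).filter fun s : ℕ => (m₁ : ℤ) ∣ (s : ℤ) * q).card = Int.gcd m₁ q := by
  have hgcd : Int.gcd m₁ q = Nat.gcd m₁ q.natAbs := rfl
  have hg : 0 < Int.gcd m₁ q := Int.gcd_pos_of_ne_zero_left _ (by exact_mod_cast h.ne')
  generalize Int.gcd m₁ q = g at hgcd hg ⊢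
  obtain ⟨d, hd⟩ : g ∣ m₁ := hgcd ▸ Nat.gcd_dvd_left _ _
  obtain ⟨e, he⟩ : g ∣ q.natAbs := hgcd ▸ Nat.gcd_dvd_right _ _
  have hdpos : 0 < d := Nat.pos_of_ne_zero (by rintro rfl; omega)
  have hde : Nat.Coprime d e := by
    rw [hd, he, Nat.gcd_mul_left] at hgcd
    exact Nat.eq_of_mul_eq_mul_left hg (by rw [← hgcd, mul_one])
  have key : ∀ s : ℕ, (m₁ : ℤ) ∣ (s : ℤ) * q ↔ d ∣ s := fun s => by
    rw [Int.natCast_dvd, Int.natAbs_mul, Int.natAbs_natCast, he, hd, mul_left_comm,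
      Nat.mul_dvd_mul_iff_left hg, hde.dvd_mul_right]
  have himg : ((Finset.range m₁).filter fun s : ℕ => (m₁ : ℤ) ∣ (s : ℤ) * q) =
      (Finset.range g).image (d * ·) := by
    ext s
    simp only [Finset.mem_filter, Finset.mem_range, Finset.mem_image, key]
    constructor
    · rintro ⟨h1, k, rfl⟩
      refine ⟨k, ?_, rfl⟩
      rw [hd, mul_comm _ d] at h1
      exact Nat.lt_of_mul_lt_mul_left h1
    · rintro ⟨k, h1, rfl⟩
      refine ⟨?_, dvd_mul_right _ _⟩
      calc d * k < d * g := Nat.mul_lt_mul_of_pos_left h1 hdpos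
        _ = m₁ := by rw [mul_comm, ← hd]
  rw [himg, Finset.card_image_of_injective _ (mul_right_injective₀ hdpos.ne'),
    Finset.card_range]

/-- The free predicate `P` lets one count serve both `zmL` and `zmL'`. -/
theorem ncard_triples (m n : ℕ) (hm : 0 < m) (hn : 0 < n) (q : ℕ → ℤ) (P : ℕ → ℕ → Prop)
    [∀ m₁, DecidablePred (P m₁)] :
    {t : ℕ × ℕ × ℕ | t.1 ∣ m ∧ t.2.1 ∣ n ∧ P t.1 t.2.1 ∧ t.2.2 < t.1 ∧
      (t.1 : ℤ) ∣ (t.2.2 : ℤ) * q t.2.1}.ncard =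
      ∑ m₁ ∈ m.divisors, ∑ n₁ ∈ n.divisors with P m₁ n₁, Int.gcd (m₁ : ℤ) (q n₁) := by
  classical
  let S : Finset ((_ : (_ : ℕ) × ℕ) × ℕ) :=
    (m.divisors.sigma fun m₁ => n.divisors.filter (P m₁)).sigma fun p =>
      (Finset.range p.1).filter fun s : ℕ => (p.1 : ℤ) ∣ (s : ℤ) * q p.2
  let e : ((_ : (_ : ℕ) × ℕ) × ℕ) → ℕ × ℕ × ℕ := fun p => (p.1.1, p.1.2, p.2)
  have he : Function.Injective e := by
    rintro ⟨⟨x, y⟩, z⟩ ⟨⟨x', y'⟩, z'⟩ h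
    simp only [e, Prod.mk.injEq] at h
    obtain ⟨rfl, rfl, rfl⟩ := h
    rfl
  have hS : {t : ℕ × ℕ × ℕ | t.1 ∣ m ∧ t.2.1 ∣ n ∧ P t.1 t.2.1 ∧ t.2.2 < t.1 ∧
      (t.1 : ℤ) ∣ (t.2.2 : ℤ) * q t.2.1} = e '' S := by
    ext ⟨x, y, z⟩
    constructor
    · rintro ⟨h1, h2, h3, h4, h5⟩
      exact ⟨⟨⟨x, y⟩, z⟩, by simp_all [S, hm.ne', hn.ne'], rfl⟩
    · rintro ⟨⟨⟨x', y'⟩, z'⟩, h1, h2⟩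
      simp only [e, Prod.mk.injEq] at h2
      obtain ⟨rfl, rfl, rfl⟩ := h2
      simp only [S, Finset.coe_sigma, Set.mem_sigma_iff, Finset.mem_coe,
        Finset.mem_filter, Nat.mem_divisors, Finset.mem_range] at h1
      simp only [Set.mem_ofPred_eq]
      tauto
  rw [hS, Set.ncard_image_of_injective _ he, Set.ncard_coe_finset, Finset.card_sigma,
    Finset.sum_sigma]
  refine Finset.sum_congr rfl fun m₁ hm₁ => Finset.sum_congr rfl fun n₁ _ => ?_
  exact card_filter_dvd_mul m₁ (Nat.pos_of_mem_divisors hm₁) (q n₁)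

theorem ncard_zmL (m n : ℕ) (r : ℤ) (hm : 0 < m) (hn : 0 < n) :
    (zmL m n r).ncard =
      ∑ m₁ ∈ m.divisors, ∑ n₁ ∈ n.divisors, Int.gcd (m₁ : ℤ) (zmQuot r n n₁) := by
  have h := ncard_triples m n hm hn (zmQuot r n) fun _ _ => True
  simp only [Finset.filter_true] at h
  rw [← h]
  congr 1
  ext t
  have h1 : t.1 ∣ m → 0 < t.1 := fun h => Nat.pos_of_dvd_of_pos h hm
  have h2 : t.2.1 ∣ n → 0 < t.2.1 := fun h => Nat.pos_of_dvd_of_pos h hn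
  simp only [zmL, Set.mem_ofPred_eq]
  tauto

theorem ncard_zmL' (m n : ℕ) (r : ℤ) (hm : 0 < m) (hn : 0 < n) :
    (zmL' m n r).ncard =
      ∑ m₁ ∈ m.divisors, ∑ n₁ ∈ n.divisors with ((m / m₁ : ℕ) : ℤ) ∣ r ^ n₁ - 1,
        Int.gcd (m₁ : ℤ) (zmQuot r n n₁) := by
  rw [← ncard_triples m n hm hn (zmQuot r n) fun m₁ n₁ => ((m / m₁ : ℕ) : ℤ) ∣ r ^ n₁ - 1]
  congr 1
  ext t
  have h1 : t.1 ∣ m → 0 < t.1 := fun h => Nat.pos_of_dvd_of_pos h hm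
  have h2 : t.2.1 ∣ n → 0 < t.2.1 := fun h => Nat.pos_of_dvd_of_pos h hn
  simp only [zmL', zmL, Set.mem_ofPred_eq]
  tauto

theorem theorem3p4p1 (m n : ℕ) (r : ℤ) (hm : 0 < m) (hn : 0 < n)
    (hmn : Nat.gcd m n = 1) (hmr : Int.gcd (m : ℤ) (r - 1) = 1)
    (hr : r ^ n ≡ 1 [ZMOD (m : ℤ)]) :
    cdeg (ZM m n r) = ((zmL' m n r).ncard : ℚ) / ((zmL m n r).ncard : ℚ) ∧
    (Nat.card (Subgroup (ZM m n r)) = (zmL m n r).ncard ∧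
      (zmL m n r).ncard =
        ∑ m₁ ∈ m.divisors, ∑ n₁ ∈ n.divisors, Int.gcd (m₁ : ℤ) (zmQuot r n n₁)) ∧
    (Nat.card {H : Subgroup (ZM m n r) // IsCyclic H} = (zmL' m n r).ncard ∧
      (zmL' m n r).ncard =
        ∑ m₁ ∈ m.divisors, ∑ n₁ ∈ n.divisors with ((m / m₁ : ℕ) : ℤ) ∣ r ^ n₁ - 1,
          Int.gcd (m₁ : ℤ) (zmQuot r n n₁)) := by
  have h : IsMetacyclicPair m n r (PresentedGroup.of 0 : ZM m n r) (PresentedGroup.of 1) :=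
    ZM.isMetacyclicPair hn hr
  have hinj := h.injOn_tripleSubgroup hn
  have hL : Nat.card (Subgroup (ZM m n r)) = (zmL m n r).ncard := by
    rw [← Set.ncard_univ, ← hinj.ncard_image]
    congr 1
    exact (Set.eq_univ_of_forall fun H => h.exists_tripleSubgroup_eq hm hn H).symm
  have hL' : Nat.card {H : Subgroup (ZM m n r) // IsCyclic H} = (zmL' m n r).ncard := by
    rw [← (hinj.mono fun t ht => ht.1).ncard_image]
    change Set.ncard {H : Subgroup (ZM m n r) | IsCyclic H} = _
    congr 1
    ext H
    constructor
    · intro hH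
      obtain ⟨t, ht, rfl⟩ := h.exists_tripleSubgroup_eq hm hn H
      exact ⟨t, ⟨ht, (h.isCyclic_tripleSubgroup_iff hmn ht).mp hH⟩, rfl⟩
    · rintro ⟨t, ht, rfl⟩
      exact (h.isCyclic_tripleSubgroup_iff hmn ht.1).mpr ht.2
  exact ⟨by rw [cdeg, hL, hL'], ⟨hL, ncard_zmL m n r hm hn⟩, hL', ncard_zmL' m n r hm hn⟩
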